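/- Let $C=\mathbb{C}[x,y]$ and let $\mathbb{Z}^2$ act on $C$ by translation, $(i,j)\in\mathbb{Z}^2$ acting as the $\mathbb{C}$-algebra automorphism $x\mapsto x+i$, $y\mapsto y+j$; write $s^{g}$ for the image of $s\in C$ under $g\in\mathbb{Z}^2$. Let $B=C\#\mathbb{Z}^2$ be the skew group ring: the free left $C$-module with basis $\mathbb{Z}^2$ and multiplication determined by $(rh)(sg)=(r\,s^{h})(hg)$ for $r,s\in C$ and $g,h\in\mathbb{Z}^2$, where $hg$ denotes the product in the group $\mathbb{Z}^2$ written multiplicatively. For a right ideal $J$ of $B$ let $\mathbb{I}_B(J)=\{b\in B : bJ\subseteq J\}$ be its idealiser, a subring of $B$. Let $I$ be a prime ideal of $C$ whose zero locus $V(I)\subseteq\mathbb{C}^2$ is a line, that is, $V(I)=\{(p,q)\in\mathbb{C}^2 : ap+bq+c=0\}$ for some $a,b,c\in\mathbb{C}$ with $(a,b)\neq(0,0)$; lines of rational slope (including slope $\infty$) are allowed. Then the idealiser $\mathbb{I}_B(IB)$ of the right ideal $IB$ of $B$ generated by $I$ is both left and right noetherian. -/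

import Mathlib

/-- The coordinate ring `ℂ[x, y]` of the affine plane, with `x = X 0` and `y = X 1`. -/
abbrev PlaneRing : Type := MvPolynomial (Fin 2) ℂ

/-- The group `ℤ²`, written multiplicatively so that it can act on `ℂ[x, y]`. -/
abbrev PlaneLattice : Type := Multiplicative (ℤ × ℤ)

/-- The `ℂ`-algebra endomorphism `x ↦ x + i`, `y ↦ y + j` of `ℂ[x, y]`. -/
noncomputable def planeTranslate (g : PlaneLattice) : PlaneRing →ₐ[ℂ] PlaneRing :=
  MvPolynomial.aeval
    ![MvPolynomial.X 0 + MvPolynomial.C (g.toAdd.1 : ℂ),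
      MvPolynomial.X 1 + MvPolynomial.C (g.toAdd.2 : ℂ)]

theorem planeTranslate_one : planeTranslate 1 = AlgHom.id ℂ PlaneRing := by
  apply MvPolynomial.algHom_ext
  intro k
  fin_cases k <;> simp [planeTranslate]

theorem planeTranslate_mul (g h : PlaneLattice) :
    planeTranslate (g * h) = (planeTranslate g).comp (planeTranslate h) := by
  apply MvPolynomial.algHom_ext
  intro k
  fin_cases k <;> simp [planeTranslate, add_assoc]

/-- The action of `ℤ²` on `ℂ[x, y]` by translation: `(i, j)` acts by `σ ^ i * τ ^ j`, where
`σ` is `x ↦ x + 1`, `y ↦ y` and `τ` is `x ↦ x`, `y ↦ y + 1`. -/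
noncomputable instance planeAction : MulSemiringAction PlaneLattice PlaneRing where
  smul g f := planeTranslate g f
  one_smul f := DFunLike.congr_fun planeTranslate_one f
  mul_smul g h f := DFunLike.congr_fun (planeTranslate_mul g h) f
  smul_zero g := map_zero (planeTranslate g)
  smul_add g := map_add (planeTranslate g)
  smul_one g := map_one (planeTranslate g)
  smul_mul g := map_mul (planeTranslate g)

theorem planeAction_smul_def (g : PlaneLattice) (f : PlaneRing) :
    g • f = planeTranslate g f := rfl

/-- The skew group ring `B = ℂ[x, y] # ℤ²`: the free left `ℂ[x, y]`-module on `ℤ²`, with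
multiplication `(r h) (s g) = (r (h • s)) (h g)`; here `r g` is `SkewMonoidAlgebra.single g r`. -/
abbrev PlaneSkewRing : Type := SkewMonoidAlgebra PlaneRing PlaneLattice

theorem planeSkewRing_single_mul_single (h g : PlaneLattice) (r s : PlaneRing) :
    (SkewMonoidAlgebra.single h r * SkewMonoidAlgebra.single g s : PlaneSkewRing) =
      SkewMonoidAlgebra.single (h * g) (r * planeTranslate h s) :=
  SkewMonoidAlgebra.single_mul_single

/-- The idealiser `{b ∈ B ∣ b J ⊆ J}` of a right ideal `J` of a ring `B`. -/
def rightIdealiser {B : Type*} [Ring B] (J : Submodule Bᵐᵒᵖ B) : Subring B where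
  carrier := {b | ∀ a ∈ J, b * a ∈ J}
  mul_mem' := fun {b c} hb hc a ha => by
    rw [mul_assoc]
    exact hb _ (hc a ha)
  one_mem' := fun a ha => by rwa [one_mul]
  add_mem' := fun {b c} hb hc a ha => by
    rw [add_mul]
    exact J.add_mem (hb a ha) (hc a ha)
  zero_mem' := fun a _ => by
    rw [zero_mul]
    exact J.zero_mem
  neg_mem' := fun {b} hb a ha => by
    rw [neg_mul]
    exact J.neg_mem (hb a ha)

/-- The right ideal `I B` of `B = ℂ[x, y] # ℤ²` generated by an ideal `I` of `ℂ[x, y]`, the ring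
`ℂ[x, y]` being embedded in `B` by `r ↦ r 1`. -/
noncomputable def planeExtendedIdeal (I : Ideal PlaneRing) :
    Submodule PlaneSkewRingᵐᵒᵖ PlaneSkewRing :=
  Submodule.span PlaneSkewRingᵐᵒᵖ
    ((fun r : PlaneRing => (SkewMonoidAlgebra.single 1 r : PlaneSkewRing)) '' (I : Set PlaneRing))

/-- A line in the affine plane over `ℂ`. -/
def IsPlaneLine (L : Set (Fin 2 → ℂ)) : Prop :=
  ∃ a b c : ℂ, (a ≠ 0 ∨ b ≠ 0) ∧ L = {p | a * p 0 + b * p 1 + c = 0}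

/-! A prime with zero locus a line is generated by its equation `l` (Nullstellensatz). A translate
`g • l` differs from `l` by a constant, so it either equals `l` or is comaximal with it. Let `H` be
the stabiliser of `l`, of rank 0 or 1; the two cases need no separate treatment. The idealiser is `R
= {b | b l ∈ l B}`, and `R = C#H + l B`. The ring `B` is noetherian on both sides by a skew Hilbert
basis theorem applied twice (`isNoetherianRing_planeSkewRing`).

To descend to `R`, let `π` restrict supports to `H`. By comaximality, for finitely many `b` there is
one `q` such that `1 + l q` carries every `b - π b` into `l B` from the right and into `B l` from
the left (`exists_one_add_mul_torsion`). Coefficients in `B` can therefore be replaced by their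
images under `π`, which lie in `R`, up to errors controlled by `l B ⊆ R`. The two
`subring_of_torsion` theorems carry this out abstractly. -/

theorem isNoetherian_mulOpposite_iff {R : Type*} [Ring R] :
    IsNoetherian Rᵐᵒᵖ R ↔ IsNoetherianRing Rᵐᵒᵖ := by
  let e : R ≃ₗ[Rᵐᵒᵖ] Rᵐᵒᵖ :=
    { MulOpposite.opAddEquiv with
      map_smul' := fun r x => by
        induction r using MulOpposite.rec' with
        | h r => simp }
  rw [isNoetherianRing_iff]
  exact e.isNoetherian_iff

/-! ### Hilbert basis theorem for a normalising unit -/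

/-- A form of the Hilbert basis theorem for rings generated by a noetherian ring and a normalising
unit, on the left. -/
theorem isNoetherianRing_of_normalizing_unit {A S : Type*} [Ring A] [Ring S] [IsNoetherianRing A]
    (f : A →+* S) (u : Sˣ) (h₁ : ∀ a, ∃ a', u * f a = f a' * u)
    (h₂ : ∀ a, ∃ a', f a * u = u * f a')
    (hS : AddSubgroup.closure {s : S | ∃ (a b : A) (k : ℤ), s = f a * ↑(u ^ k) * f b} = ⊤) :
    IsNoetherianRing S := by
  let : Module A S := Module.compHom S f
  have smul_def : ∀ (a : A) (s : S), a • s = f a * s := fun _ _ => rfl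
  have h₁n : ∀ (n : ℕ) a, ∃ a', (u : S) ^ n * f a = f a' * (u : S) ^ n := by
    intro n
    induction n with
    | zero => exact fun a => ⟨a, by simp⟩
    | succ n ih =>
      intro a
      obtain ⟨b, hb⟩ := h₁ a
      obtain ⟨c, hc⟩ := ih b
      exact ⟨c, by rw [pow_succ, mul_assoc, hb, ← mul_assoc, hc, mul_assoc]⟩
  have h₂n : ∀ (n : ℕ) a, ∃ a', f a * (u : S) ^ n = (u : S) ^ n * f a' := by
    intro n
    induction n with
    | zero => exact fun a => ⟨a, by simp⟩
    | succ n ih =>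
      intro a
      obtain ⟨b, hb⟩ := ih a
      obtain ⟨c, hc⟩ := h₂ b
      exact ⟨c, by rw [pow_succ, ← mul_assoc, hb, mul_assoc, hc, mul_assoc]⟩
  -- The "polynomials in `u` of degree less than `n`".
  let P : ℕ → Submodule A S := fun n => Submodule.span A ((fun k : ℕ => (u : S) ^ k) '' Set.Iio n)
  have P_mono : Monotone P := fun m n h =>
    Submodule.span_mono (Set.image_mono (Set.Iio_subset_Iio h))
  have pow_mem : ∀ {k n : ℕ}, k < n → (u : S) ^ k ∈ P n := fun h =>
    Submodule.subset_span ⟨_, h, rfl⟩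
  have pow_mul_mem : ∀ {k n : ℕ} (a : A), k < n → (u : S) ^ k * f a ∈ P n := by
    intro k n a h
    obtain ⟨b, hb⟩ := h₁n k a
    rw [hb, ← smul_def]
    exact (P n).smul_mem _ (pow_mem h)
  have P_shift : ∀ (d n : ℕ) (s : S), s ∈ P n → (u : S) ^ d * s ∈ P (d + n) := by
    intro d n s hs
    induction hs using Submodule.span_induction with
    | mem x hx =>
      obtain ⟨k, hk, rfl⟩ := hx
      simp only [← pow_add]
      exact pow_mem (by simp at hk; omega)
    | zero => simp
    | add x y _ _ hx hy => rw [mul_add]; exact add_mem hx hy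
    | smul a x _ hx =>
      obtain ⟨b, hb⟩ := h₁n d a
      rw [smul_def, ← mul_assoc, hb, mul_assoc, ← smul_def]
      exact (P _).smul_mem _ hx
  have P_top : ∀ (n : ℕ) (s : S), s ∈ P (n + 1) → ∃ a, s - (u : S) ^ n * f a ∈ P n := by
    intro n s hs
    have : (fun k : ℕ => (u : S) ^ k) '' Set.Iio (n + 1) =
        insert ((u : S) ^ n) ((fun k : ℕ => (u : S) ^ k) '' Set.Iio n) := by
      rw [← Set.image_insert_eq]
      congr 1
      ext k
      simp only [Set.mem_Iio, Set.mem_insert_iff]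
      omega
    simp only [P] at hs
    rw [this, Submodule.mem_span_insert] at hs
    obtain ⟨a, z, hz, rfl⟩ := hs
    obtain ⟨b, hb⟩ := h₂n n a
    exact ⟨b, by rw [smul_def, hb]; simpa using hz⟩
  have P_noeth : ∀ n, IsNoetherian A (P n) := fun n =>
    isNoetherian_span_of_finite A ((Set.finite_Iio n).image _)
  -- Negative powers of `u` can be cleared by a left multiplication.
  have exhaust : ∀ s : S, ∃ n m : ℕ, (u : S) ^ n * s ∈ P m := by
    intro s
    have hs : s ∈ AddSubgroup.closure {s : S | ∃ (a b : A) (k : ℤ), s = f a * ↑(u ^ k) * f b} :=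
      hS ▸ AddSubgroup.mem_top s
    induction hs using AddSubgroup.closure_induction with
    | mem x hx =>
      obtain ⟨a, b, k, rfl⟩ := hx
      obtain ⟨c, hc⟩ := h₁n k.natAbs a
      obtain ⟨j, hj⟩ : ∃ j : ℕ, (k.natAbs : ℤ) + k = j := ⟨(k.natAbs + k).toNat, by omega⟩
      refine ⟨k.natAbs, j + 1, ?_⟩
      have : (u : S) ^ k.natAbs * (f a * ↑(u ^ k) * f b) = c • ((u : S) ^ j * f b) := by
        have hu : (u : S) ^ k.natAbs * ↑(u ^ k) = (u : S) ^ j := by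
          rw [← Units.val_pow_eq_pow_val, ← Units.val_mul, ← zpow_natCast, ← zpow_add, hj,
            zpow_natCast, Units.val_pow_eq_pow_val]
        rw [smul_def, ← hu, ← mul_assoc, ← mul_assoc, hc]
        simp only [mul_assoc]
      rw [this]
      exact (P _).smul_mem _ (pow_mul_mem b (by omega))
    | zero => exact ⟨0, 0, by simp⟩
    | add x y _ _ hx hy =>
      obtain ⟨n, m, h⟩ := hx
      obtain ⟨n', m', h'⟩ := hy
      refine ⟨n + n', (n' + m) + (n + m'), ?_⟩
      have e : (u : S) ^ (n + n') * (x + y) = (u : S) ^ n' * ((u : S) ^ n * x) +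
          (u : S) ^ n * ((u : S) ^ n' * y) := by
        rw [← mul_assoc, ← mul_assoc, ← pow_add, ← pow_add, mul_add, add_comm n' n]
      rw [e]
      exact add_mem (P_mono (by omega) (P_shift n' m _ h)) (P_mono (by omega) (P_shift n m' _ h'))
    | neg x _ hx =>
      obtain ⟨n, m, h⟩ := hx
      exact ⟨n, m, by rw [mul_neg]; exact neg_mem h⟩
  rw [isNoetherianRing_iff_ideal_fg]
  intro N
  -- Ideals of leading coefficients. Powers of `u` may be dependent, so a leading coefficient is not
  -- unique. It is written on the right so that left multiplication by `u` preserves it.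
  let Λ : ℕ →o Ideal A :=
    { toFun := fun n =>
        { carrier := {a | ∃ s ∈ N, s - (u : S) ^ n * f a ∈ P n}
          zero_mem' := ⟨0, N.zero_mem, by simp⟩
          add_mem' := by
            rintro a b ⟨s, hs, hs'⟩ ⟨t, ht, ht'⟩
            refine ⟨s + t, N.add_mem hs ht, ?_⟩
            have : s + t - (u : S) ^ n * f (a + b) =
                (s - (u : S) ^ n * f a) + (t - (u : S) ^ n * f b) := by
              rw [map_add, mul_add]; abel
            rw [this]
            exact add_mem hs' ht'
          smul_mem' := by
            rintro c a ⟨s, hs, hs'⟩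
            obtain ⟨d, hd⟩ := h₁n n c
            refine ⟨f d * s, N.mul_mem_left _ hs, ?_⟩
            have : f d * s - (u : S) ^ n * f (c • a) = d • (s - (u : S) ^ n * f a) := by
              rw [smul_def, smul_eq_mul, map_mul, ← mul_assoc, hd, mul_sub, mul_assoc]
            rw [this]
            exact (P n).smul_mem _ hs' }
      monotone' := by
        refine monotone_nat_of_le_succ fun n => ?_
        rintro a ⟨s, hs, hs'⟩
        refine ⟨(u : S) ^ 1 * s, N.mul_mem_left _ hs, ?_⟩
        have : (u : S) ^ 1 * s - (u : S) ^ (n + 1) * f a =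
            (u : S) ^ 1 * (s - (u : S) ^ n * f a) := by
          rw [add_comm n 1, pow_add, mul_sub, mul_assoc]
        rw [this, add_comm n 1]
        exact P_shift _ _ _ hs' }
  obtain ⟨m, hm⟩ := monotone_stabilizes_iff_noetherian.2 ‹IsNoetherianRing A› Λ
  let NA : Submodule A S :=
    { carrier := N
      zero_mem' := N.zero_mem
      add_mem' := N.add_mem
      smul_mem' := fun c _ hx => N.mul_mem_left (f c) hx }
  let Q : Submodule A S := NA ⊓ P (m + 1)
  obtain ⟨F, hF⟩ : Q.FG :=
    isNoetherian_submodule.1 (P_noeth (m + 1)) Q inf_le_right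
  let T : Ideal S := Ideal.span (F : Set S)
  have hFQ : (F : Set S) ⊆ Q := hF ▸ Submodule.subset_span
  have hQT : ∀ s ∈ Q, s ∈ T := by
    intro s hs
    rw [← hF] at hs
    induction hs using Submodule.span_induction with
    | mem x hx => exact Ideal.subset_span hx
    | zero => exact T.zero_mem
    | add x y _ _ hx hy => exact T.add_mem hx hy
    | smul a x _ hx => exact T.mul_mem_left _ hx
  -- Above degree `m`, the leading term is cancelled by a power of `u` times an element of `Q`.
  have key : ∀ n, ∀ s ∈ N, s ∈ P n → s ∈ T := by
    intro n
    induction n with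
    | zero => exact fun s hs hs' => hQT s ⟨hs, P_mono (Nat.zero_le _) hs'⟩
    | succ n ih =>
      intro s hs hs'
      rcases lt_or_ge m n with hmn | hmn
      · obtain ⟨a, ha⟩ := P_top n s hs'
        obtain ⟨t, ht, ht'⟩ : a ∈ Λ m := by
          rw [hm n hmn.le]
          exact ⟨s, hs, ha⟩
        obtain ⟨d, rfl⟩ := Nat.exists_eq_add_of_lt hmn
        have htT : t ∈ T := by
          refine hQT t ⟨ht, ?_⟩
          have := add_mem (P_mono (Nat.le_succ m) ht') (pow_mul_mem a (Nat.lt_succ_self m))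
          simpa using this
        have hd : s - (u : S) ^ (d + 1) * t ∈ T := by
          refine ih _ (N.sub_mem hs (N.mul_mem_left _ ht)) ?_
          have e : s - (u : S) ^ (d + 1) * t = (s - (u : S) ^ (m + d + 1) * f a) -
              (u : S) ^ (d + 1) * (t - (u : S) ^ m * f a) := by
            rw [show m + d + 1 = (d + 1) + m by omega, pow_add _ (d + 1) m, mul_sub, mul_assoc]
            abel
          rw [e]
          refine sub_mem ha ?_
          have := P_shift (d + 1) m _ ht'
          rwa [show d + 1 + m = m + d + 1 by omega] at this
        have := T.add_mem hd (T.mul_mem_left ((u : S) ^ (d + 1)) htT)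
        simpa using this
      · exact hQT s ⟨hs, P_mono (by omega) hs'⟩
  refine ⟨F, le_antisymm (Ideal.span_le.2 fun s hs => (hFQ hs).1) fun s hs => ?_⟩
  obtain ⟨n, k, h⟩ := exhaust s
  have := T.mul_mem_left (↑(u ^ n)⁻¹ : S) (key k _ (N.mul_mem_left _ hs) h)
  rwa [← Units.val_pow_eq_pow_val, Units.inv_mul_cancel_left] at this

/-- The two-sided version of `isNoetherianRing_of_normalizing_unit`. -/
theorem isNoetherianRing_and_op_of_normalizing_unit {A S : Type*} [Ring A] [Ring S]
    (hA : IsNoetherianRing A ∧ IsNoetherianRing Aᵐᵒᵖ)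
    (f : A →+* S) (u : Sˣ) (h₁ : ∀ a, ∃ a', u * f a = f a' * u)
    (h₂ : ∀ a, ∃ a', f a * u = u * f a')
    (hS : AddSubgroup.closure {s : S | ∃ (a b : A) (k : ℤ), s = f a * ↑(u ^ k) * f b} = ⊤) :
    IsNoetherianRing S ∧ IsNoetherianRing Sᵐᵒᵖ := by
  obtain ⟨hA₁, hA₂⟩ := hA
  refine ⟨isNoetherianRing_of_normalizing_unit f u h₁ h₂ hS, ?_⟩
  -- Passing to opposites swaps `h₁` and `h₂` and preserves the shape of the generators `f a * u ^ k
  -- * f b`.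
  refine isNoetherianRing_of_normalizing_unit f.op (Units.opEquiv.symm (MulOpposite.op u)) ?_ ?_ ?_
  · intro a
    obtain ⟨b, hb⟩ := h₂ a.unop
    exact ⟨MulOpposite.op b, MulOpposite.unop_injective (by simpa using hb)⟩
  · intro a
    obtain ⟨b, hb⟩ := h₁ a.unop
    exact ⟨MulOpposite.op b, MulOpposite.unop_injective (by simpa using hb)⟩
  · rw [eq_top_iff]
    intro s _
    have hs : s.unop ∈ AddSubgroup.closure
        {s : S | ∃ (a b : A) (k : ℤ), s = f a * ↑(u ^ k) * f b} := hS ▸ AddSubgroup.mem_top _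
    induction s using MulOpposite.rec' with
    | h s =>
    simp only [MulOpposite.unop_op] at hs
    clear * - hs
    induction hs using AddSubgroup.closure_induction with
    | mem x hx =>
      obtain ⟨a, b, k, rfl⟩ := hx
      refine AddSubgroup.subset_closure ⟨MulOpposite.op b, MulOpposite.op a, k, ?_⟩
      have : Units.opEquiv.symm (MulOpposite.op u) ^ k =
          Units.opEquiv.symm (MulOpposite.op (u ^ k)) := by
        rw [← map_zpow, MulOpposite.op_zpow]
      rw [this]
      simp only [MulOpposite.op_mul, mul_assoc]
      rfl
    | zero => simp
    | add x y _ _ hx hy => rw [MulOpposite.op_add]; exact add_mem hx hy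
    | neg x _ hx => rw [MulOpposite.op_neg]; exact neg_mem hx

/-! ### Descent of the noetherian property to a subring containing `L * B` -/

open MulOpposite in
/-- Let `L` be an element of a right noetherian ring `B`, and let `π` be a map on `B`
such that the elements `b - π b` become left multiples of `L` on right multiplication by suitable
elements `1 + L * q`. Then every subring containing `L * B` and the image of `π` is right
noetherian. -/
theorem isNoetherian_mulOpposite_subring_of_torsion {B : Type*} [Ring B] [IsNoetherian Bᵐᵒᵖ B]
    (L : B) (R : Subring B) (π : B → B) (hπ : ∀ b, π b ∈ R) (hL : ∀ b, L * b ∈ R)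
    (hq : ∀ T : Finset B, ∃ q, ∀ b ∈ T, ∃ c, (b - π b) * (1 + L * q) = L * c) :
    IsNoetherian Rᵐᵒᵖ R := by
  classical
  refine ⟨fun N => ?_⟩
  let ι : R → B := Subtype.val
  -- One finite set `E ⊆ N` is to generate both `N B` and `N L B` over `B`.
  obtain ⟨F₁, hF₁, hs₁⟩ := (Submodule.fg_span_iff_fg_span_finset_subset (R := Bᵐᵒᵖ)
    (ι '' N)).1 (IsNoetherian.noetherian _)
  obtain ⟨F₂, hF₂, hs₂⟩ := (Submodule.fg_span_iff_fg_span_finset_subset (R := Bᵐᵒᵖ)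
    ((fun n : R => (n : B) * L) '' N)).1 (IsNoetherian.noetherian _)
  obtain ⟨E₁, hE₁, rfl⟩ := Finset.subset_set_image_iff.1 hF₁
  obtain ⟨E₂, hE₂, rfl⟩ := Finset.subset_set_image_iff.1 hF₂
  let E : Finset R := E₁ ∪ E₂
  have hE : ∀ n ∈ E, n ∈ N := fun n hn =>
    (Finset.mem_union.1 hn).elim (fun h => hE₁ h) (fun h => hE₂ h)
  have gen₁ : ∀ n ∈ N, (n : B) ∈ Submodule.span Bᵐᵒᵖ (ι '' E) := by
    intro n hn
    have : (n : B) ∈ Submodule.span Bᵐᵒᵖ (ι '' N) := Submodule.subset_span ⟨n, hn, rfl⟩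
    rw [hs₁] at this
    refine Submodule.span_mono ?_ this
    rw [Finset.coe_image]
    exact Set.image_mono (by simp [E])
  have gen₂ : ∀ n ∈ N, ∀ c : B, (n : B) * L * c ∈
      Submodule.span Bᵐᵒᵖ ((fun n : R => (n : B) * L) '' E) := by
    intro n hn c
    have : (n : B) * L ∈ Submodule.span Bᵐᵒᵖ ((fun n : R => (n : B) * L) '' N) :=
      Submodule.subset_span ⟨n, hn, rfl⟩
    rw [hs₂] at this
    refine Submodule.smul_mem _ (op c) (Submodule.span_mono ?_ this)
    rw [Finset.coe_image]
    exact Set.image_mono (by simp [E])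
  -- `E L B ⊆ E R`, because `L B ⊆ R`.
  have gen₂' : ∀ x : R, (x : B) ∈ Submodule.span Bᵐᵒᵖ ((fun n : R => (n : B) * L) '' E) →
      x ∈ Submodule.span Rᵐᵒᵖ (E : Set R) := by
    intro x hx
    obtain ⟨c, hc⟩ := (Submodule.mem_span_image_finset_iff_exists_fun' _).1 hx
    have : x = ∑ n ∈ E, op (⟨L * (c n).unop, hL _⟩ : R) • n := by
      apply Subtype.ext
      rw [← hc]
      simp [mul_assoc]
    rw [this]
    exact Submodule.sum_mem _ fun n hn => Submodule.smul_mem _ _ (Submodule.subset_span hn)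
  refine ⟨E, le_antisymm (Submodule.span_le.2 hE) fun x hx => ?_⟩
  obtain ⟨c, hc⟩ := (Submodule.mem_span_image_finset_iff_exists_fun' _).1 (gen₁ x hx)
  let p : R → R := fun n => ⟨π (c n).unop, hπ _⟩
  let z : R := ∑ n ∈ E, op (p n) • n
  have hz : z ∈ Submodule.span Rᵐᵒᵖ (E : Set R) :=
    Submodule.sum_mem _ fun n hn => Submodule.smul_mem _ _ (Submodule.subset_span hn)
  have hzN : z ∈ N := Submodule.sum_mem _ fun n hn => Submodule.smul_mem _ _ (hE n hn)
  have hy : ((x - z : R) : B) = ∑ n ∈ E, (n : B) * ((c n).unop - π (c n).unop) := by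
    rw [AddSubgroupClass.coe_sub, ← hc]
    simp [z, p, ι, mul_sub]
  obtain ⟨q, hq⟩ := hq (E.image fun n => (c n).unop)
  have h₁ : ((x - z : R) : B) * (1 + L * q) ∈
      Submodule.span Bᵐᵒᵖ ((fun n : R => (n : B) * L) '' E) := by
    rw [hy, Finset.sum_mul]
    refine Submodule.sum_mem _ fun n hn => ?_
    obtain ⟨d, hd⟩ := hq _ (Finset.mem_image_of_mem _ hn)
    rw [mul_assoc, hd, ← mul_assoc]
    exact gen₂ n (hE n hn) d
  -- The surplus `(x - z) L q` lies in `N L B`, since `x - z ∈ N`.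
  have h₂ : ((x - z : R) : B) ∈ Submodule.span Bᵐᵒᵖ ((fun n : R => (n : B) * L) '' E) := by
    have := Submodule.sub_mem _ h₁ (gen₂ (x - z) (N.sub_mem hx hzN) q)
    rwa [mul_add, mul_one, mul_assoc, add_sub_cancel_right] at this
  simpa using Submodule.add_mem _ (gen₂' _ h₂) hz

/-- Let `L` be an element of a left noetherian ring `B`, and let `π` be an additive projection of
`B` onto a subring of the centralizer of `L` such that the elements `b - π b` become right multiples
of `L` on left multiplication by suitable elements `1 + q * L`. Then every subring that contains
`L * B` and is the sum of `L * B` and the image of `π` is left noetherian. -/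
theorem isNoetherianRing_subring_of_torsion {B : Type*} [Ring B] [IsNoetherianRing B]
    (L : B) (R : Subring B) (π : B →+ B) (hπ : ∀ b, π b ∈ R) (hL : ∀ b, L * b ∈ R)
    (hcomm : ∀ b, π b * L = L * π b) (hone : π 1 = 1)
    (hmul : ∀ b d, π (b * π d) = π b * π d)
    (hR : ∀ r ∈ R, ∃ c, r - π r = L * c)
    (hq : ∀ T : Finset B, ∃ q, ∀ b ∈ T, ∃ c, (1 + q * L) * (b - π b) = c * L) :
    IsNoetherianRing R := by
  classical
  rw [isNoetherianRing_iff]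
  refine ⟨fun N => ?_⟩
  let ι : R → B := Subtype.val
  -- `N` is controlled by three left `B`-modules: `B N`, `B X` and `B π(N)`. Generators of each,
  -- those of `X` multiplied by `L`, span `W`.
  let X : Set B := {b | (⟨L * b, hL b⟩ : R) ∈ N}
  obtain ⟨E, hE, hEs⟩ := (Submodule.fg_span_iff_fg_span_finset_subset (R := B) (ι '' N)).1
    (IsNoetherian.noetherian _)
  obtain ⟨E, hEN, rfl⟩ := Finset.subset_set_image_iff.1 hE
  obtain ⟨F, hF, hFs⟩ := (Submodule.fg_span_iff_fg_span_finset_subset (R := B) X).1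
    (IsNoetherian.noetherian _)
  obtain ⟨K, hK, hKs⟩ := (Submodule.fg_span_iff_fg_span_finset_subset (R := B)
    ((fun n : R => π n) '' N)).1 (IsNoetherian.noetherian _)
  obtain ⟨K, hKN, rfl⟩ := Finset.subset_set_image_iff.1 hK
  let m : B → R := fun b => ⟨L * b, hL b⟩
  let W : Submodule R R := Submodule.span R (E ∪ (F.image m) ∪ K : Finset R)
  have hEW : ∀ n ∈ E, n ∈ W := fun n hn => Submodule.subset_span (by simp [hn])
  have hFW : ∀ x ∈ F, m x ∈ W := fun x hx => Submodule.subset_span (by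
    simp only [Finset.coe_union, Finset.coe_image, Set.mem_union]
    exact Or.inl (Or.inr ⟨x, hx, rfl⟩))
  have hKW : ∀ n ∈ K, n ∈ W := fun n hn => Submodule.subset_span (by simp [hn])
  have hWN : W ≤ N := by
    refine Submodule.span_le.2 ?_
    intro n hn
    simp only [Finset.coe_union, Finset.coe_image, Set.mem_union] at hn
    rcases hn with (hn | ⟨x, hx, rfl⟩) | hn
    · exact hEN hn
    · exact hF hx
    · exact hKN hn
  have genE : ∀ b : B, b ∈ Submodule.span B (ι '' N) → m b ∈ W := by
    intro b hb
    rw [hEs, Finset.coe_image] at hb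
    obtain ⟨c, hc⟩ := (Submodule.mem_span_image_finset_iff_exists_fun' _).1 hb
    have : m b = ∑ n ∈ E, m (c n) • n := by
      apply Subtype.ext
      simp [m, ← hc, Finset.mul_sum, mul_assoc, ι]
    rw [this]
    exact Submodule.sum_mem _ fun n hn => Submodule.smul_mem _ _ (hEW n hn)
  have memX : ∀ b ∈ X, ∀ a, a * (L * b) ∈ Submodule.span B (ι '' N) := fun b hb a =>
    Submodule.smul_mem _ a (Submodule.subset_span ⟨_, hb, rfl⟩)
  have genF : ∀ b ∈ X, m b ∈ W := by
    intro x hx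
    have hx' : x ∈ Submodule.span B (id '' (F : Set B)) := by
      rw [Set.image_id, ← hFs]
      exact Submodule.subset_span hx
    obtain ⟨c, hc⟩ := (Submodule.mem_span_image_finset_iff_exists_fun' _).1 hx'
    let p : B → R := fun b => ⟨π (c b), hπ _⟩
    -- Since `π (c b)` commutes with `L`, the element `L z` is an `R`-combination of the `L b` with
    -- `b ∈ F`.
    let z : B := ∑ b ∈ F, π (c b) * b
    have hz : m z = ∑ b ∈ F, p b • m b := by
      apply Subtype.ext
      simp only [m, z, p, Finset.mul_sum, smul_eq_mul, AddSubmonoidClass.coe_finsetSum,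
        Subring.coe_mul]
      exact Finset.sum_congr rfl fun b _ => by rw [← mul_assoc, ← hcomm, mul_assoc]
    have hzW : m z ∈ W := by
      rw [hz]
      exact Submodule.sum_mem _ fun n hn => Submodule.smul_mem _ _ (hFW n hn)
    have hm : m x = m (x - z) + m z := Subtype.ext (by simp [m, mul_sub])
    have hyX : x - z ∈ X := by
      have : m (x - z) = m x - m z := by rw [hm, add_sub_cancel_right]
      change m (x - z) ∈ N
      rw [this]
      exact N.sub_mem hx (hWN hzW)
    have hy : x - z = ∑ b ∈ F, (c b - π (c b)) * b := by
      simp [← hc, z, sub_mul]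
    obtain ⟨q, hq⟩ := hq (F.image c)
    have h₁ : (1 + q * L) * (x - z) ∈ Submodule.span B (ι '' N) := by
      rw [hy, Finset.mul_sum]
      refine Submodule.sum_mem _ fun b hb => ?_
      obtain ⟨d, hd⟩ := hq _ (Finset.mem_image_of_mem _ hb)
      rw [← mul_assoc, hd, mul_assoc]
      exact memX b (hF hb) d
    -- The surplus `q L (x - z)` lies in `B N` because `x - z ∈ X`.
    have h₂ : x - z ∈ Submodule.span B (ι '' N) := by
      have := Submodule.sub_mem _ h₁ (memX (x - z) hyX q)
      rwa [add_mul, one_mul, mul_assoc, add_sub_cancel_right] at this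
    rw [hm]
    exact W.add_mem (genE _ h₂) hzW
  refine ⟨_, le_antisymm hWN fun n hn => ?_⟩
  have hn' : π n ∈ Submodule.span B ((fun n : R => π n) '' (K : Set R)) := by
    rw [← Finset.coe_image, ← hKs]
    exact Submodule.subset_span ⟨n, hn, rfl⟩
  obtain ⟨c, hc⟩ := (Submodule.mem_span_image_finset_iff_exists_fun' _).1 hn'
  let p : R → R := fun k => ⟨π (c k), hπ _⟩
  let z : R := ∑ k ∈ K, p k • k
  have hzW : z ∈ W := Submodule.sum_mem _ fun k hk => Submodule.smul_mem _ _ (hKW k hk)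
  -- Applying `π` to the relation over `B` moves its coefficients into `R`.
  have hπn : π n = ∑ k ∈ K, π (c k) * π k := by
    have hidem : π (π n) = π n := by simpa [hone] using hmul 1 n
    rw [← hidem, ← hc, map_sum]
    exact Finset.sum_congr rfl fun k _ => hmul _ _
  choose d hd using fun r : R => hR r r.2
  have hdiff : n - z = m (d n - ∑ k ∈ K, π (c k) * d k) := by
    apply Subtype.ext
    have e : ((n - z : R) : B) = (n - π n) - ∑ k ∈ K, π (c k) * (k - π k) := by
      rw [hπn]
      simp [z, p, mul_sub]
    rw [e, hd]
    simp only [hd, m, mul_sub, Finset.mul_sum, ← mul_assoc, hcomm]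
  have hX : d n - ∑ k ∈ K, π (c k) * d k ∈ X := by
    change m _ ∈ N
    rw [← hdiff]
    exact N.sub_mem hn (hWN hzW)
  have := W.add_mem (genF _ hX) hzW
  rwa [← hdiff, sub_add_cancel] at this

/-! ### Skew group rings: subrings supported in a subgroup -/

namespace SkewMonoidAlgebra

section Supported

variable {k G : Type*} [Ring k] [Group G] [MulSemiringAction G k]

theorem mem_addSubgroup_of_single_mem {k G : Type*} [Ring k]
    {T : AddSubgroup (SkewMonoidAlgebra k G)} {b : SkewMonoidAlgebra k G} (h : ∀ g, single g (b.coeff g) ∈ T) : b ∈ T := by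
  rw [← sum_single b, sum_def']
  exact sum_mem fun g _ => h g

/-- The subring of the elements of a skew group ring supported in a subgroup. -/
def supported (k : Type*) {G : Type*} [Ring k] [Group G] [MulSemiringAction G k] (H : Subgroup G) :
    Subring (SkewMonoidAlgebra k G) where
  carrier := {b | ∀ g ∉ H, b.coeff g = 0}
  mul_mem' := by
    classical
    intro a b ha hb g hg
    rw [coeff_mul_left, sum_def']
    refine Finset.sum_eq_zero fun x _ => ?_
    by_cases hx : x ∈ H
    · rw [hb (x⁻¹ * g) fun h => hg (by simpa using H.mul_mem hx h), smul_zero, mul_zero]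
    · rw [ha x hx, zero_mul]
  one_mem' := by
    classical
    intro g hg
    rw [coeff_one, Finsupp.single_eq_of_ne]
    rintro rfl
    exact hg H.one_mem
  add_mem' := fun ha hb g hg => by rw [coeff_add, Finsupp.add_apply, ha g hg, hb g hg, add_zero]
  zero_mem' := fun _ _ => rfl
  neg_mem' := fun ha g hg => by rw [coeff_neg, Finsupp.neg_apply, ha g hg, neg_zero]

theorem single_mem_supported {H : Subgroup G} {g : G} (hg : g ∈ H) (r : k) :
    single g r ∈ supported k H := by
  classical
  intro x hx
  rw [coeff_single, Finsupp.single_eq_of_ne]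
  rintro rfl
  exact hx hg

theorem supported_mono {H K : Subgroup G} (h : H ≤ K) : supported k H ≤ supported k K :=
  fun _ hb g hg => hb g fun h' => hg (h h')

theorem supported_closure {H : Subgroup G} {b : SkewMonoidAlgebra k G} (hb : b ∈ supported k H)
    {T : AddSubgroup (SkewMonoidAlgebra k G)} (hT : ∀ g ∈ H, ∀ r, single g r ∈ T) : b ∈ T := by
  refine mem_addSubgroup_of_single_mem fun g => ?_
  by_cases hg : g ∈ H
  · exact hT g hg _
  · rw [hb g hg, single_zero_right]
    exact T.zero_mem

theorem isNoetherianRing_supported_bot {k G : Type*} [CommRing k] [Group G] [MulSemiringAction G k]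
    [IsNoetherianRing k] :
    IsNoetherianRing (supported k (⊥ : Subgroup G)) ∧
      IsNoetherianRing (supported k (⊥ : Subgroup G))ᵐᵒᵖ := by
  classical
  let f : k →+* supported k (⊥ : Subgroup G) :=
    singleOneRingHom.codRestrict _ fun r => single_mem_supported (Subgroup.one_mem _) r
  have hf : Function.Surjective f := by
    rintro ⟨b, hb⟩
    refine ⟨b.coeff 1, Subtype.ext ?_⟩
    change single 1 (b.coeff 1) = b
    ext g
    by_cases hg : g = 1
    · simp [hg]
    · rw [coeff_single, Finsupp.single_eq_of_ne hg, hb g (by simpa using hg)]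
  have : IsNoetherianRing kᵐᵒᵖ := isNoetherianRing_of_ringEquiv k (RingEquiv.toOpposite k)
  refine ⟨isNoetherianRing_of_surjective _ _ f hf, isNoetherianRing_of_surjective _ _ f.op ?_⟩
  intro b
  obtain ⟨r, hr⟩ := hf b.unop
  exact ⟨MulOpposite.op r, MulOpposite.unop_injective (by simpa using hr)⟩

/-- As `G` is commutative, conjugation by `u` preserves supports, so `single u 1` is a unit
normalising the smaller ring. -/
theorem isNoetherianRing_supported_sup_zpowers {k G : Type*} [Ring k] [CommGroup G]
    [MulSemiringAction G k] (H : Subgroup G) (u : G)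
    (hH : IsNoetherianRing (supported k H) ∧ IsNoetherianRing (supported k H)ᵐᵒᵖ) :
    IsNoetherianRing (supported k (H ⊔ Subgroup.zpowers u)) ∧
      IsNoetherianRing (supported k (H ⊔ Subgroup.zpowers u))ᵐᵒᵖ := by
  let K := H ⊔ Subgroup.zpowers u
  have hu : u ∈ K := Subgroup.mem_sup_right (Subgroup.mem_zpowers u)
  let ψ : K →* supported k K :=
    ((of k G).comp K.subtype).codRestrict (supported k K)
      fun g => by simpa using single_mem_supported g.2 1
  let U : (supported k K)ˣ := ψ.toHomUnits ⟨u, hu⟩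
  have hU : ∀ n : ℤ, ((↑(U ^ n) : supported k K) : SkewMonoidAlgebra k G) = single (u ^ n) 1 := by
    intro n
    simp only [U]
    rw [← map_zpow, MonoidHom.coe_toHomUnits]
    simp [ψ]
  have hU₁ : ((U : supported k K) : SkewMonoidAlgebra k G) = single u 1 := by
    simpa using hU 1
  let f : supported k H →+* supported k K := Subring.inclusion (supported_mono le_sup_left)
  have hconj : ∀ (v : G) (b : SkewMonoidAlgebra k G), b ∈ supported k H →
      single v 1 * b * single v⁻¹ 1 ∈ supported k H := by
    intro v b hb g hg
    rw [coeff_mul_single, coeff_single_mul]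
    have : v⁻¹ * (g * v⁻¹⁻¹) = g := by rw [inv_inv, mul_comm g, inv_mul_cancel_left]
    rw [this, hb g hg]
    simp
  refine isNoetherianRing_and_op_of_normalizing_unit hH f U ?_ ?_ ?_
  · intro a
    refine ⟨⟨_, hconj u a a.2⟩, Subtype.ext ?_⟩
    change (U : supported k K).1 * a.1 = single u 1 * a.1 * single u⁻¹ 1 * (U : supported k K).1
    rw [hU₁, mul_assoc _ (single u⁻¹ 1)]
    simp
  · intro a
    refine ⟨⟨_, hconj u⁻¹ a a.2⟩, Subtype.ext ?_⟩
    change a.1 * (U : supported k K).1 =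
      (U : supported k K).1 * (single u⁻¹ 1 * a.1 * single u⁻¹⁻¹ 1)
    rw [hU₁, ← mul_assoc, ← mul_assoc]
    simp
  · rw [eq_top_iff]
    intro s _
    let T := AddSubgroup.closure
      {s : supported k K | ∃ (a b : supported k H) (k : ℤ), s = f a * ↑(U ^ k) * f b}
    suffices s.1 ∈ T.map (supported k K).subtype.toAddMonoidHom by
      obtain ⟨t, ht, hts⟩ := this
      rwa [← Subtype.ext (a1 := t) (a2 := s) hts]
    refine supported_closure s.2 fun g hg r => ?_
    obtain ⟨h, hh, w, hw, rfl⟩ := Subgroup.mem_sup.1 hg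
    obtain ⟨n, rfl⟩ := Subgroup.mem_zpowers_iff.1 hw
    refine ⟨_, AddSubgroup.subset_closure ⟨⟨_, single_mem_supported hh r⟩, 1, n, rfl⟩, ?_⟩
    change (single h r * ((↑(U ^ n) : supported k K) : SkewMonoidAlgebra k G)) * 1 = _
    rw [hU]
    simp

theorem isNoetherianRing_of_supported_top
    (h : IsNoetherianRing (supported k (⊤ : Subgroup G)) ∧
      IsNoetherianRing (supported k (⊤ : Subgroup G))ᵐᵒᵖ) :
    IsNoetherianRing (SkewMonoidAlgebra k G) ∧ IsNoetherianRing (SkewMonoidAlgebra k G)ᵐᵒᵖ := by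
  obtain ⟨h₁, h₂⟩ := h
  have hs : Function.Surjective (supported k (⊤ : Subgroup G)).subtype :=
    fun b => ⟨⟨b, fun g hg => absurd (Subgroup.mem_top g) hg⟩, rfl⟩
  refine ⟨isNoetherianRing_of_surjective _ _ _ hs,
    isNoetherianRing_of_surjective _ _ (supported k (⊤ : Subgroup G)).subtype.op ?_⟩
  intro b
  obtain ⟨r, hr⟩ := hs b.unop
  exact ⟨MulOpposite.op r, MulOpposite.unop_injective (by simpa using hr)⟩

end Supported

/-! ### Restriction of supports -/

section Restrict

variable {k G : Type*} [Ring k] [Group G]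

open Classical in
/-- The restriction of the support of an element of a skew group ring to a subgroup. -/
noncomputable def restrict (H : Subgroup G) : SkewMonoidAlgebra k G →+ SkewMonoidAlgebra k G :=
  (coeffAddEquiv.symm.toAddMonoidHom.comp (Finsupp.filterAddHom (· ∈ H))).comp
    coeffAddEquiv.toAddMonoidHom

theorem coeff_restrict_of_mem {H : Subgroup G} {g : G} (hg : g ∈ H) (b : SkewMonoidAlgebra k G) :
    (restrict H b).coeff g = b.coeff g := by
  classical
  exact Finsupp.filter_apply_pos _ _ hg

theorem coeff_restrict_of_notMem {H : Subgroup G} {g : G} (hg : g ∉ H)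
    (b : SkewMonoidAlgebra k G) : (restrict H b).coeff g = 0 := by
  classical
  exact Finsupp.filter_apply_neg _ _ hg

theorem coeff_sub_restrict_of_mem {H : Subgroup G} {g : G} (hg : g ∈ H)
    (b : SkewMonoidAlgebra k G) : (b - restrict H b).coeff g = 0 := by
  rw [coeff_sub, Finsupp.sub_apply, coeff_restrict_of_mem hg, sub_self]

theorem coeff_sub_restrict_of_notMem {H : Subgroup G} {g : G} (hg : g ∉ H)
    (b : SkewMonoidAlgebra k G) : (b - restrict H b).coeff g = b.coeff g := by
  rw [coeff_sub, Finsupp.sub_apply, coeff_restrict_of_notMem hg, sub_zero]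

variable [MulSemiringAction G k]

theorem restrict_one (H : Subgroup G) : restrict H (1 : SkewMonoidAlgebra k G) = 1 := by
  classical
  ext g
  by_cases hg : g ∈ H
  · rw [coeff_restrict_of_mem hg]
  · rw [coeff_restrict_of_notMem hg, (supported k H).one_mem g hg]

/-- Right multiplication by `H` preserves both `H` and its complement. -/
theorem restrict_mul_restrict (H : Subgroup G) (b d : SkewMonoidAlgebra k G) :
    restrict H (b * restrict H d) = restrict H b * restrict H d := by
  classical
  have hd : ∀ x g : G, x⁻¹ * g ∉ H → (restrict H d).coeff (x⁻¹ * g) = 0 :=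
    fun x g h => coeff_restrict_of_notMem h d
  ext g
  by_cases hg : g ∈ H
  · rw [coeff_restrict_of_mem hg, ← sub_eq_zero, ← Finsupp.sub_apply, ← coeff_sub, ← sub_mul,
      coeff_mul_left, sum_def']
    refine Finset.sum_eq_zero fun x _ => ?_
    by_cases hx : x ∈ H
    · rw [coeff_sub_restrict_of_mem hx, zero_mul]
    · rw [hd x g fun h => hx ?_, smul_zero, mul_zero]
      simpa using H.mul_mem hg (H.inv_mem h)
  · rw [coeff_restrict_of_notMem hg]
    exact ((supported k H).mul_mem (x := restrict H b) (y := restrict H d)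
      (fun g hg => coeff_restrict_of_notMem hg b)
      (fun g hg => coeff_restrict_of_notMem hg d) g hg).symm

end Restrict

/-! ### The idealiser of a principal right ideal -/

section Line

variable {k G : Type*} [CommRing k] [Group G] [MulSemiringAction G k]

theorem exists_single_one_mul_of_dvd {l : k} {b : SkewMonoidAlgebra k G}
    (h : ∀ g, l ∣ b.coeff g) : ∃ c, b = single 1 l * c := by
  suffices b ∈ (AddMonoidHom.mulLeft (single 1 l : SkewMonoidAlgebra k G)).range by
    obtain ⟨c, hc⟩ := this
    exact ⟨c, hc.symm⟩
  refine mem_addSubgroup_of_single_mem fun g => ?_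
  obtain ⟨r, hr⟩ := h g
  exact ⟨single g r, by simp [hr]⟩

/-- Moving `l` to the left past `g` turns it into `g • l`. -/
theorem exists_mul_single_one_of_dvd {l : k} {b : SkewMonoidAlgebra k G}
    (h : ∀ g : G, g • l ∣ b.coeff g) : ∃ c, b = c * single 1 l := by
  suffices b ∈ (AddMonoidHom.mulRight (single 1 l : SkewMonoidAlgebra k G)).range by
    obtain ⟨c, hc⟩ := this
    exact ⟨c, hc.symm⟩
  refine mem_addSubgroup_of_single_mem fun g => ?_
  obtain ⟨r, hr⟩ := h g
  exact ⟨single g r, by simp [hr, mul_comm]⟩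

theorem restrict_stabilizer_mul_comm (l : k) (b : SkewMonoidAlgebra k G) :
    restrict (MulAction.stabilizer G l) b * single 1 l =
      single 1 l * restrict (MulAction.stabilizer G l) b := by
  ext g
  rw [coeff_mul_single_one, coeff_single_one_mul]
  by_cases hg : g ∈ MulAction.stabilizer G l
  · rw [MulAction.mem_stabilizer_iff.1 hg, mul_comm]
  · rw [coeff_restrict_of_notMem hg, zero_mul, mul_zero]

/-- If `g • l - l` is a unit with inverse fixed by `g` for all `g ∈ T`, then some `1 + l * q` is a
multiple of all translates `g • l`, and all its translates are multiples of `l`. -/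
theorem exists_one_add_mul_dvd (l : k) (T : Finset G)
    (hT : ∀ g ∈ T, ∃ v : k, v * (g • l - l) = 1 ∧ g • v = v) :
    ∃ q, ∀ g ∈ T, g • l ∣ 1 + l * q ∧ l ∣ g • (1 + l * q) := by
  classical
  induction T using Finset.induction_on with
  | empty => exact ⟨0, by simp⟩
  | insert g T _ ih =>
    obtain ⟨q, hq⟩ := ih fun g hg => hT g (Finset.mem_insert_of_mem hg)
    obtain ⟨v, hv, hgv⟩ := hT g (Finset.mem_insert_self _ _)
    -- The new factor is `1 - v² l²`: `1 + v l` is a multiple of `g • l`, and `g` carries `1 - v l`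
    -- to `-v l`.
    have e : 1 + l * (q - v ^ 2 * l * (1 + l * q)) = (1 + v * l) * (1 - v * l) * (1 + l * q) := by
      ring
    have h₁ : 1 + v * l = g • l * v := by linear_combination -hv
    have h₂ : g • (1 - v * l) = l * (-v) := by
      rw [smul_sub, smul_mul', smul_one, hgv]
      linear_combination -hv
    refine ⟨q - v ^ 2 * l * (1 + l * q), fun h hh => ?_⟩
    rw [e]
    rcases Finset.mem_insert.1 hh with rfl | hh
    · constructor
      · rw [h₁, mul_assoc, mul_assoc]
        exact dvd_mul_right _ _
      · rw [smul_mul', smul_mul', h₂]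
        exact Dvd.dvd.mul_right (Dvd.dvd.mul_left (dvd_mul_right _ _) _) _
    · constructor
      · exact Dvd.dvd.mul_left (hq h hh).1 _
      · rw [smul_mul']
        exact Dvd.dvd.mul_left (hq h hh).2 _

/-- At `g`, right multiplication by `1 + l q` scales the coefficient by `g • (1 + l q)`, and left
multiplication scales it by `1 + l q`. Only finitely many `g` occur in the supports. -/
theorem exists_one_add_mul_torsion (l : k)
    (hl : ∀ g ∉ MulAction.stabilizer G l, ∃ v : k, v * (g • l - l) = 1 ∧ g • v = v)
    (T : Finset (SkewMonoidAlgebra k G)) :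
    ∃ q : SkewMonoidAlgebra k G, q * single 1 l = single 1 l * q ∧ ∀ b ∈ T,
      (∃ c, (b - restrict (MulAction.stabilizer G l) b) * (1 + single 1 l * q) =
        single 1 l * c) ∧
      ∃ c, (1 + q * single 1 l) * (b - restrict (MulAction.stabilizer G l) b) =
        c * single 1 l := by
  classical
  obtain ⟨q, hq⟩ := exists_one_add_mul_dvd (G := G) l
    ((T.biUnion support).filter (· ∉ MulAction.stabilizer G l))
    fun g hg => hl g (Finset.mem_filter.1 hg).2
  have e₁ : (1 + single 1 l * single 1 q : SkewMonoidAlgebra k G) = single 1 (1 + l * q) := by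
    rw [single_add, one_def]; simp
  have e₂ : (1 + single 1 q * single 1 l : SkewMonoidAlgebra k G) = single 1 (1 + l * q) := by
    rw [single_add, one_def]; simp [mul_comm]
  refine ⟨single 1 q, by simp [mul_comm], fun b hb => ⟨?_, ?_⟩⟩
  · refine exists_single_one_mul_of_dvd fun g => ?_
    rw [e₁, coeff_mul_single_one]
    by_cases hg : g ∈ MulAction.stabilizer G l
    · rw [coeff_sub_restrict_of_mem hg, zero_mul]
      exact dvd_zero l
    · rw [coeff_sub_restrict_of_notMem hg]
      by_cases h0 : b.coeff g = 0
      · rw [h0, zero_mul]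
        exact dvd_zero l
      · refine Dvd.dvd.mul_left (hq g ?_).2 _
        exact Finset.mem_filter.2 ⟨Finset.mem_biUnion.2 ⟨b, hb, mem_support_iff.2 h0⟩, hg⟩
  · refine exists_mul_single_one_of_dvd fun g => ?_
    rw [e₂, coeff_single_one_mul]
    by_cases hg : g ∈ MulAction.stabilizer G l
    · rw [coeff_sub_restrict_of_mem hg, mul_zero]
      exact dvd_zero _
    · rw [coeff_sub_restrict_of_notMem hg]
      by_cases h0 : b.coeff g = 0
      · rw [h0, mul_zero]
        exact dvd_zero _
      · refine Dvd.dvd.mul_right (hq g ?_).1 _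
        exact Finset.mem_filter.2 ⟨Finset.mem_biUnion.2 ⟨b, hb, mem_support_iff.2 h0⟩, hg⟩

/-- Let `k # G` be a left and right noetherian skew group ring, and let `l ∈ k` be such that each
nonzero `g • l - l` is a unit with inverse fixed by `g`. Then the idealiser of the right ideal
generated by `l` is left and right noetherian. -/
theorem isNoetherian_idealiser
    (hB : IsNoetherianRing (SkewMonoidAlgebra k G) ∧ IsNoetherianRing (SkewMonoidAlgebra k G)ᵐᵒᵖ)
    (l : k) (hl : ∀ g ∉ MulAction.stabilizer G l, ∃ v : k, v * (g • l - l) = 1 ∧ g • v = v)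
    (R : Subring (SkewMonoidAlgebra k G))
    (hR : ∀ b, b ∈ R ↔ ∃ c, b * single 1 l = single 1 l * c) :
    IsNoetherian R R ∧ IsNoetherian Rᵐᵒᵖ R := by
  obtain ⟨hB₁, hB₂⟩ := hB
  have := isNoetherian_mulOpposite_iff.2 hB₂
  have hπ : ∀ b, restrict (MulAction.stabilizer G l) b ∈ R := fun b =>
    (hR _).2 ⟨_, restrict_stabilizer_mul_comm l b⟩
  have hL : ∀ b, single 1 l * b ∈ R := fun b => (hR _).2 ⟨b * single 1 l, mul_assoc _ _ _⟩
  constructor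
  · refine isNoetherianRing_subring_of_torsion (single 1 l) R
      (restrict (MulAction.stabilizer G l)) hπ hL (restrict_stabilizer_mul_comm l)
      (restrict_one _) (restrict_mul_restrict _) ?_ ?_
    · intro r hr
      obtain ⟨q, hql, hq⟩ := exists_one_add_mul_torsion l hl {r}
      obtain ⟨c, hc⟩ := (hq r (Finset.mem_singleton_self r)).1
      obtain ⟨d, hd⟩ := (hR r).1 hr
      -- Solves `(r - π r)(1 + l q) = l c` using `(r - π r) l = l (d - π r)`.
      refine ⟨c - (d - restrict (MulAction.stabilizer G l) r) * q, ?_⟩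
      rw [mul_add, mul_one, ← mul_assoc, sub_mul _ _ (single 1 l), hd,
        restrict_stabilizer_mul_comm, ← mul_sub, mul_assoc] at hc
      rw [mul_sub, ← hc, add_sub_cancel_right]
    · intro T
      obtain ⟨q, -, hq⟩ := exists_one_add_mul_torsion l hl T
      exact ⟨q, fun b hb => (hq b hb).2⟩
  · refine isNoetherian_mulOpposite_subring_of_torsion (single 1 l) R
      (restrict (MulAction.stabilizer G l)) hπ hL fun T => ?_
    obtain ⟨q, -, hq⟩ := exists_one_add_mul_torsion l hl T
    exact ⟨q, fun b hb => (hq b hb).1⟩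

end Line

end SkewMonoidAlgebra

/-! ### The plane and its lines -/

/-- A prime ideal of `ℂ[x, y]` whose zero locus is a line is generated by the equation of the
line. -/
theorem eq_span_of_zeroLocus_eq_line (I : Ideal PlaneRing) [I.IsPrime] (a b c : ℂ)
    (hab : a ≠ 0 ∨ b ≠ 0)
    (hI : MvPolynomial.zeroLocus ℂ I = {p | a * p 0 + b * p 1 + c = 0}) :
    I = Ideal.span {MvPolynomial.C a * MvPolynomial.X 0 + MvPolynomial.C b * MvPolynomial.X 1 +
      MvPolynomial.C c} := by
  set l : PlaneRing := MvPolynomial.C a * MvPolynomial.X 0 +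
    MvPolynomial.C b * MvPolynomial.X 1 + MvPolynomial.C c with hl
  have hI' : I = MvPolynomial.vanishingIdeal ℂ {p : Fin 2 → ℂ | a * p 0 + b * p 1 + c = 0} := by
    rw [← hI, MvPolynomial.IsPrime.vanishingIdeal_zeroLocus]
  -- A direction transverse to the line.
  obtain ⟨v, hv⟩ : ∃ v : Fin 2 → ℂ, a * v 0 + b * v 1 = 1 := by
    rcases hab with h | h
    · exact ⟨![a⁻¹, 0], by simp [h]⟩
    · exact ⟨![0, b⁻¹], by simp [h]⟩
  apply le_antisymm
  · intro f hf
    rw [hI', MvPolynomial.mem_vanishingIdeal_iff] at hf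
    -- Composition with the projection onto the line along `v`: it kills `f`, yet is the identity
    -- modulo `l`.
    let φ : PlaneRing →ₐ[ℂ] PlaneRing :=
      MvPolynomial.aeval fun i => MvPolynomial.X i - MvPolynomial.C (v i) * l
    have hφ : φ f = 0 := by
      apply MvPolynomial.funext
      intro p
      have e : (MvPolynomial.aeval p).comp φ = MvPolynomial.aeval (R := ℂ)
          fun i => p i - v i * (a * p 0 + b * p 1 + c) := by
        apply MvPolynomial.algHom_ext
        intro i
        simp [φ, hl]
      have := DFunLike.congr_fun e f
      rw [hf _ (by
        change a * (p 0 - v 0 * _) + b * (p 1 - v 1 * _) + c = 0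
        linear_combination -(a * p 0 + b * p 1 + c) * hv)] at this
      simpa [MvPolynomial.aeval_eq_eval] using this
    have e : (Ideal.Quotient.mkₐ ℂ (Ideal.span {l})).comp φ =
        Ideal.Quotient.mkₐ ℂ (Ideal.span {l}) := by
      apply MvPolynomial.algHom_ext
      intro i
      have : Ideal.Quotient.mk (Ideal.span {l}) l = 0 :=
        Ideal.Quotient.eq_zero_iff_mem.2 (Ideal.mem_span_singleton_self l)
      simp [φ, this]
    have := DFunLike.congr_fun e f
    rw [AlgHom.comp_apply, hφ, map_zero] at this
    exact Ideal.Quotient.eq_zero_iff_mem.1 this.symm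
  · rw [Ideal.span_singleton_le_iff_mem, hI', MvPolynomial.mem_vanishingIdeal_iff]
    intro p hp
    simpa [hl] using hp

theorem isNoetherianRing_planeSkewRing :
    IsNoetherianRing PlaneSkewRing ∧ IsNoetherianRing PlaneSkewRingᵐᵒᵖ := by
  apply SkewMonoidAlgebra.isNoetherianRing_of_supported_top
  have h := SkewMonoidAlgebra.isNoetherianRing_supported_sup_zpowers _
    (Multiplicative.ofAdd ((0, 1) : ℤ × ℤ))
    (SkewMonoidAlgebra.isNoetherianRing_supported_sup_zpowers _
      (Multiplicative.ofAdd ((1, 0) : ℤ × ℤ))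
      (SkewMonoidAlgebra.isNoetherianRing_supported_bot (k := PlaneRing) (G := PlaneLattice)))
  have e : (⊥ ⊔ Subgroup.zpowers (Multiplicative.ofAdd ((1, 0) : ℤ × ℤ))) ⊔
      Subgroup.zpowers (Multiplicative.ofAdd ((0, 1) : ℤ × ℤ)) = (⊤ : Subgroup PlaneLattice) := by
    rw [eq_top_iff]
    rintro g -
    refine Subgroup.mem_sup.2 ⟨Multiplicative.ofAdd ((1, 0) : ℤ × ℤ) ^ g.toAdd.1,
      Subgroup.mem_sup_right ⟨_, rfl⟩, Multiplicative.ofAdd ((0, 1) : ℤ × ℤ) ^ g.toAdd.2,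
      ⟨_, rfl⟩, ?_⟩
    apply Multiplicative.toAdd.injective
    ext <;> simp
  rwa [e] at h

theorem mem_planeExtendedIdeal_span_singleton (l : PlaneRing) (x : PlaneSkewRing) :
    x ∈ planeExtendedIdeal (Ideal.span {l}) ↔
      ∃ c, x = (SkewMonoidAlgebra.single 1 l : PlaneSkewRing) * c := by
  have e : planeExtendedIdeal (Ideal.span {l}) = Submodule.span PlaneSkewRingᵐᵒᵖ
      {(SkewMonoidAlgebra.single 1 l : PlaneSkewRing)} := by
    apply le_antisymm
    · refine Submodule.span_le.2 ?_
      rintro _ ⟨r, hr, rfl⟩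
      obtain ⟨s, rfl⟩ := Ideal.mem_span_singleton'.1 hr
      refine Submodule.mem_span_singleton.2 ⟨MulOpposite.op (SkewMonoidAlgebra.single 1 s), ?_⟩
      simp [mul_comm]
    · refine Submodule.span_mono ?_
      rintro _ rfl
      exact ⟨l, Ideal.mem_span_singleton_self l, rfl⟩
  rw [e, Submodule.mem_span_singleton]
  constructor
  · rintro ⟨c, rfl⟩
    exact ⟨c.unop, rfl⟩
  · rintro ⟨c, rfl⟩
    exact ⟨MulOpposite.op c, rfl⟩

theorem mem_rightIdealiser_planeExtendedIdeal (l : PlaneRing) (b : PlaneSkewRing) :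
    b ∈ rightIdealiser (planeExtendedIdeal (Ideal.span {l})) ↔
      ∃ c, b * SkewMonoidAlgebra.single 1 l =
        (SkewMonoidAlgebra.single 1 l : PlaneSkewRing) * c := by
  change (∀ a ∈ planeExtendedIdeal (Ideal.span {l}), b * a ∈ _) ↔ _
  constructor
  · intro h
    exact (mem_planeExtendedIdeal_span_singleton l _).1
      (h _ ((mem_planeExtendedIdeal_span_singleton l _).2 ⟨1, (mul_one _).symm⟩))
  · rintro ⟨c, hc⟩ a ha
    obtain ⟨d, rfl⟩ := (mem_planeExtendedIdeal_span_singleton l _).1 ha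
    exact (mem_planeExtendedIdeal_span_singleton l _).2
      ⟨c * d, by rw [← mul_assoc, hc, mul_assoc]⟩

theorem planeTranslate_linear_sub (a b c : ℂ) (g : PlaneLattice) :
    g • (MvPolynomial.C a * MvPolynomial.X 0 + MvPolynomial.C b * MvPolynomial.X 1 +
        MvPolynomial.C c : PlaneRing) -
      (MvPolynomial.C a * MvPolynomial.X 0 + MvPolynomial.C b * MvPolynomial.X 1 +
        MvPolynomial.C c) =
      MvPolynomial.C (a * (g.toAdd.1 : ℂ) + b * (g.toAdd.2 : ℂ)) := by
  rw [planeAction_smul_def]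
  simp only [planeTranslate, map_add, map_mul, MvPolynomial.aeval_X, MvPolynomial.aeval_C,
    MvPolynomial.algebraMap_eq, Matrix.cons_val_zero, Matrix.cons_val_one]
  ring

theorem mainTheorem11 (I : Ideal PlaneRing) (hI : I.IsPrime)
    (hline : IsPlaneLine (MvPolynomial.zeroLocus ℂ I)) :
    IsNoetherian (rightIdealiser (planeExtendedIdeal I))
        (rightIdealiser (planeExtendedIdeal I)) ∧
      IsNoetherian (rightIdealiser (planeExtendedIdeal I))ᵐᵒᵖ
        (rightIdealiser (planeExtendedIdeal I)) := by
  obtain ⟨a, b, c, hab, hL⟩ := hline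
  obtain rfl := eq_span_of_zeroLocus_eq_line I a b c hab hL
  refine SkewMonoidAlgebra.isNoetherian_idealiser isNoetherianRing_planeSkewRing _ ?_ _
    (mem_rightIdealiser_planeExtendedIdeal _)
  intro g hg
  have h := planeTranslate_linear_sub a b c g
  -- The difference `g • l - l` is a nonzero constant, and translations fix constants.
  refine ⟨MvPolynomial.C (a * (g.toAdd.1 : ℂ) + b * (g.toAdd.2 : ℂ))⁻¹, ?_, ?_⟩
  · rw [h, ← MvPolynomial.C_mul, inv_mul_cancel₀, MvPolynomial.C_1]
    intro h0
    rw [h0, MvPolynomial.C_0, sub_eq_zero] at h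
    exact hg h
  · rw [planeAction_smul_def]
    exact (planeTranslate g).commutes _
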